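/- Let $k$ be a perfect field and let $L$ be a complete discretely valued extension of $k$ with residue field $k$, with ring of integers $\mathcal O_L$, maximal ideal $\mathfrak m_L$ and a uniformizer $\pi$. For a $k$-algebra $A$ put $\mathbb O_L(A)=\varprojlim_n A\otimes_k \mathcal O_L/\mathfrak m_L^n$ and $\mathbb L(A)=\mathbb O_L(A)\otimes_{\mathcal O_L}L$, and let $\mathbb L^\times$ be the ind-$k$-scheme $A\mapsto \mathbb L(A)^\times$. Write $\Pi$ for $\pi$ viewed as an element of $\mathbb L(k)=L$; then $\mathbb L(A)=A((\Pi))$ and $\mathbb L^\times(A)=A((\Pi))^\times$. Let $\varphi:\mathrm{Spec}(L)\to\mathbb L^\times$ be the morphism given by the $L$-point $(\Pi-\pi)^{-1}\Pi\in L((\Pi))^\times$. Let $K$ be a closed subextension of $k$ in $L$ such that $L/K$ is finite, and let $d=[L:K]$. For a field $F\in\{k,K\}$ and an $F$-algebra $B$, let $\mathrm{TS}^d_F(B)=(B^{\otimes_F d})^{\mathfrak S_d}$, so that $\mathrm{Sym}^d_F(\mathrm{Spec}\,B)=\mathrm{Spec}\,\mathrm{TS}^d_F(B)$; for an ind-affine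 $k$-scheme $X=\varinjlim_i X_i$ let $\mathrm{Sym}^d_k(X)=\varinjlim_i\mathrm{Sym}^d_k(X_i)$ be the quotient of $X^d$ by $\mathfrak S_d$. Let $\psi:\mathrm{Spec}(K)\to \mathrm{Sym}^d_K(\mathrm{Spec}\,L)$ be the canonical (norm) morphism, corresponding to the $K$-algebra homomorphism $\mathrm{TS}^d_K(L)\to K$ which sends $c\otimes\cdots\otimes c$ to $N_{L/K}(c)$ for every $c\in L$. Then the composition $$\mathrm{Spec}(K)\xrightarrow{\ \psi\ }\mathrm{Sym}^d_K(\mathrm{Spec}\,L)\to\mathrm{Sym}^d_k(\mathrm{Spec}\,L)\xrightarrow{\mathrm{Sym}^d_k(\varphi)}\mathrm{Sym}^d_k(\mathbb L^\times)\to\mathbb L^\times,$$ where the second morphism is the canonical one and the last morphism is given by the multiplication, corresponds to the $K$-point $P_\pi(\Pi)^{-1}\Pi^d\in K((\Pi))^\times$ of $\mathbb L^\times$, where $P_\pi$ is the characteristic polynomial of the $K$-linear endomorphism $x\mapsto \pi x$ of $L$. -/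

import Mathlib

open CategoryTheory
open scoped TensorProduct
universe u

noncomputable section
namespace LoopSym

/-! ### Symmetric tensors -/

section SymTensors

variable (R : Type*) [CommRing R] (d : ℕ)

/-- The action of a permutation of `Fin d` on `B ⊗ ⋯ ⊗ B` (`d` factors) by permuting factors:
`x₁ ⊗ ⋯ ⊗ x_d ↦ x_{σ 1} ⊗ ⋯ ⊗ x_{σ d}`. -/
def permHom (B : Type*) [CommRing B] [Algebra R B] (σ : Equiv.Perm (Fin d)) :
    (⨂[R] _ : Fin d, B) →ₐ[R] (⨂[R] _ : Fin d, B) :=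
  PiTensorProduct.liftAlgHom
    ((PiTensorProduct.tprod R (s := fun _ : Fin d => B)).domDomCongr σ)
    (by simp [PiTensorProduct.one_def]; rfl)
    (fun x y => by simp [PiTensorProduct.tprod_mul_tprod]; rfl)

theorem permHom_tprod (B : Type*) [CommRing B] [Algebra R B] (σ : Equiv.Perm (Fin d))
    (x : Fin d → B) :
    permHom R d B σ (PiTensorProduct.tprod R x) = PiTensorProduct.tprod R (fun i => x (σ i)) := by
  simp [permHom]

/-- `TS^d_R(B)`: the `R`-algebra of symmetric tensors of degree `d` with coefficients in `B`. -/
def symTensors (B : Type*) [CommRing B] [Algebra R B] : Subalgebra R (⨂[R] _ : Fin d, B) :=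
  ⨅ σ : Equiv.Perm (Fin d), AlgHom.equalizer (permHom R d B σ) (AlgHom.id R _)

theorem mem_symTensors {B : Type*} [CommRing B] [Algebra R B] (t : ⨂[R] _ : Fin d, B) :
    t ∈ symTensors R d B ↔ ∀ σ, permHom R d B σ t = t := by
  simp [symTensors, Algebra.mem_iInf, AlgHom.mem_equalizer]

/-- The `d`-th tensor power of an algebra homomorphism. -/
def tensorPowMap {B C : Type*} [CommRing B] [Algebra R B] [CommRing C] [Algebra R C]
    (f : B →ₐ[R] C) : (⨂[R] _ : Fin d, B) →ₐ[R] (⨂[R] _ : Fin d, C) :=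
  PiTensorProduct.liftAlgHom
    ((PiTensorProduct.tprod R (s := fun _ : Fin d => C)).compLinearMap fun _ => f.toLinearMap)
    (by simp [PiTensorProduct.one_def]; rfl)
    (fun x y => by simp [PiTensorProduct.tprod_mul_tprod]; rfl)

theorem tensorPowMap_tprod {B C : Type*} [CommRing B] [Algebra R B] [CommRing C] [Algebra R C]
    (f : B →ₐ[R] C) (x : Fin d → B) :
    tensorPowMap R d f (PiTensorProduct.tprod R x) = PiTensorProduct.tprod R (fun i => f (x i)) := by
  simp [tensorPowMap]

theorem tensorAlgHom_ext {B C : Type*} [CommRing B] [Algebra R B] [CommRing C] [Algebra R C]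
    {f g : (⨂[R] _ : Fin d, B) →ₐ[R] C}
    (h : ∀ x : Fin d → B, f (PiTensorProduct.tprod R x) = g (PiTensorProduct.tprod R x)) :
    f = g :=
  AlgHom.toLinearMap_injective <| PiTensorProduct.ext <| MultilinearMap.ext h

theorem permHom_tensorPowMap {B C : Type*} [CommRing B] [Algebra R B] [CommRing C] [Algebra R C]
    (f : B →ₐ[R] C) (σ : Equiv.Perm (Fin d)) (t : ⨂[R] _ : Fin d, B) :
    permHom R d C σ (tensorPowMap R d f t) = tensorPowMap R d f (permHom R d B σ t) := by
  have : (permHom R d C σ).comp (tensorPowMap R d f)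
      = (tensorPowMap R d f).comp (permHom R d B σ) :=
    tensorAlgHom_ext R d fun x => by simp [permHom_tprod, tensorPowMap_tprod]
  exact DFunLike.congr_fun this t

/-- The homomorphism `TS^d_R(B) → TS^d_R(C)` induced by `f : B → C`. -/
def symTensorsMap {B C : Type*} [CommRing B] [Algebra R B] [CommRing C] [Algebra R C]
    (f : B →ₐ[R] C) : symTensors R d B →ₐ[R] symTensors R d C :=
  ((tensorPowMap R d f).comp (symTensors R d B).val).codRestrict _ fun t => by
    rw [mem_symTensors]
    intro σ
    have ht := (mem_symTensors R d _).1 t.2 σ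
    simp [permHom_tensorPowMap, ht]

theorem symTensorsMap_coe {B C : Type*} [CommRing B] [Algebra R B] [CommRing C] [Algebra R C]
    (f : B →ₐ[R] C) (t : symTensors R d B) :
    (symTensorsMap R d f t : ⨂[R] _ : Fin d, C) = tensorPowMap R d f t := rfl

theorem symTensorsMap_id (B : Type*) [CommRing B] [Algebra R B] :
    symTensorsMap R d (AlgHom.id R B) = AlgHom.id R _ := by
  have : tensorPowMap R d (AlgHom.id R B) = AlgHom.id R _ :=
    tensorAlgHom_ext R d fun x => by simp [tensorPowMap_tprod]
  ext t
  simp [symTensorsMap_coe, this]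

theorem symTensorsMap_comp {B C D : Type*} [CommRing B] [Algebra R B] [CommRing C] [Algebra R C]
    [CommRing D] [Algebra R D] (f : B →ₐ[R] C) (g : C →ₐ[R] D) :
    symTensorsMap R d (g.comp f) = (symTensorsMap R d g).comp (symTensorsMap R d f) := by
  have : tensorPowMap R d (g.comp f) = (tensorPowMap R d g).comp (tensorPowMap R d f) :=
    tensorAlgHom_ext R d fun x => by simp [tensorPowMap_tprod]
  ext t
  simp [symTensorsMap_coe, this]

/-- The `d`-th divided power `γ_d(c) = c ⊗ ⋯ ⊗ c`, a symmetric tensor. -/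
def tensorDiag {C : Type*} [CommRing C] [Algebra R C] (c : C) : symTensors R d C :=
  ⟨PiTensorProduct.tprod R fun _ => c, (mem_symTensors R d _).2 fun σ => by
    rw [permHom_tprod]⟩

end SymTensors

/-! ### The norm homomorphism on symmetric tensors -/

section Norm

variable {R C : Type*} [CommRing R] [CommRing C] [Algebra R C] {d : ℕ}

/-- The `R`-linear form on `C ⊗ ⋯ ⊗ C` induced by the determinant with respect to a basis. -/
def detForm (b : Module.Basis (Fin d) R C) : (⨂[R] _ : Fin d, C) →ₗ[R] R :=
  PiTensorProduct.lift b.det.toMultilinearMap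

theorem detForm_tprod (b : Module.Basis (Fin d) R C) (x : Fin d → C) :
    detForm b (PiTensorProduct.tprod R x) = b.det x := by
  simp [detForm]

/-- The determinant form kills every tensor invariant under a transposition. -/
theorem detForm_eq_zero (b : Module.Basis (Fin d) R C) {i j : Fin d} (hij : i ≠ j)
    (y : ⨂[R] _ : Fin d, C) (hy : permHom R d C (Equiv.swap i j) y = y) : detForm b y = 0 := by
  let e := Basis.piTensorProduct (fun _ : Fin d => b)
  have he : ∀ p, e p = PiTensorProduct.tprod R (fun i => b (p i)) :=
    fun p => Basis.piTensorProduct_apply _ p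
  have hperm : ∀ p : Fin d → Fin d,
      permHom R d C (Equiv.swap i j) (e p) = e (fun l => p (Equiv.swap i j l)) := fun p => by
    rw [he, he, permHom_tprod]
  have hrepr : ∀ p : Fin d → Fin d, e.repr y (fun l => p (Equiv.swap i j l)) = e.repr y p := by
    intro p
    have h1 : e.coord (fun l => p (Equiv.swap i j l)) ∘ₗ
        (permHom R d C (Equiv.swap i j)).toLinearMap = e.coord p := by
      refine e.ext fun q => ?_
      simp only [LinearMap.comp_apply, AlgHom.toLinearMap_apply, hperm, Module.Basis.coord_apply,
        Module.Basis.repr_self, Finsupp.single_apply]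
      congr 1
      refine propext ⟨fun h => funext fun l => ?_, fun h => by rw [h]⟩
      have := congr_fun h (Equiv.swap i j l)
      simpa using this
    have h2 := DFunLike.congr_fun h1 y
    simpa [hy] using h2
  rw [← e.sum_repr y, map_sum]
  refine Finset.sum_involution (fun p _ l => p (Equiv.swap i j l)) ?_ ?_ ?_ ?_
  · intro p _
    rw [map_smul, map_smul, hrepr, he, he, detForm_tprod, detForm_tprod, ← smul_add]
    have := b.det.map_swap (fun l => b (p l)) hij
    simp only [Function.comp_def] at this
    rw [this, add_neg_cancel, smul_zero]
  · intro p _ hne heq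
    apply hne
    have hp : p i = p j := by
      have := congr_fun heq i
      simpa using this.symm
    rw [map_smul, he, detForm_tprod, b.det.map_eq_zero_of_eq _ (by rw [hp]) hij, smul_zero]
  · intro p _; exact Finset.mem_univ _
  · intro p _; funext l; simp

/-- For a symmetric tensor `t`, the alternating form `x ↦ det (t · (x₁ ⊗ ⋯ ⊗ x_d))`. -/
def detAlt (b : Module.Basis (Fin d) R C) (t : symTensors R d C) : C [⋀^Fin d]→ₗ[R] R :=
  { ((detForm b).comp (LinearMap.mulLeft R (t : ⨂[R] _ : Fin d, C))).compMultilinearMap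
      (PiTensorProduct.tprod R) with
    map_eq_zero_of_eq' := fun x i j hx hij => by
      refine detForm_eq_zero b hij _ ?_
      have ht := (mem_symTensors R d _).1 t.2 (Equiv.swap i j)
      simp only [LinearMap.mulLeft_apply, map_mul, ht, permHom_tprod]
      congr 2
      funext l
      by_cases hi : l = i
      · subst hi; simp [hx]
      by_cases hj : l = j
      · subst hj; simp [hx]
      rw [Equiv.swap_apply_of_ne_of_ne hi hj] }

theorem detAlt_apply (b : Module.Basis (Fin d) R C) (t : symTensors R d C) (x : Fin d → C) :
    detAlt b t x = detForm b (t * PiTensorProduct.tprod R x) := rfl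

theorem detForm_mul (b : Module.Basis (Fin d) R C) (t : symTensors R d C)
    (y : ⨂[R] _ : Fin d, C) :
    detForm b (t * y) = detForm b (t * PiTensorProduct.tprod R b) * detForm b y := by
  have : (detForm b).comp (LinearMap.mulLeft R (t : ⨂[R] _ : Fin d, C))
      = (detForm b (t * PiTensorProduct.tprod R b)) • detForm b := by
    refine PiTensorProduct.ext (MultilinearMap.ext fun x => ?_)
    have h := DFunLike.congr_fun ((detAlt b t).eq_smul_basis_det b) x
    simpa [detAlt_apply, detForm_tprod] using h
  exact DFunLike.congr_fun this y

/-- The canonical homomorphism `TS^d_R(C) → R` for an `R`-algebra `C` which is free of rank `d`: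
a symmetric tensor `t` acts on the top exterior power of `C`, a free module of rank one, through
multiplication by a scalar, and this scalar is the image of `t`. It sends `c ⊗ ⋯ ⊗ c` to the norm
of `c` (see `symNorm_tensorDiag`), and over an infinite field it is the only linear form with this
property, because the tensors `c ⊗ ⋯ ⊗ c` then span `TS^d_R(C)`. -/
def symNorm (b : Module.Basis (Fin d) R C) : symTensors R d C →ₐ[R] R :=
  AlgHom.ofLinearMap
    ((detForm b).comp
      ((LinearMap.mulRight R (PiTensorProduct.tprod R b)).comp (symTensors R d C).val.toLinearMap))
    (by simp [detForm_tprod, b.det_self])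
    (fun s t => by
      simp only [LinearMap.comp_apply, AlgHom.toLinearMap_apply, Subalgebra.coe_val, map_mul,
        LinearMap.mulRight_apply, mul_assoc]
      exact detForm_mul b s _)

theorem symNorm_apply (b : Module.Basis (Fin d) R C) (t : symTensors R d C) :
    symNorm b t = detForm b (t * PiTensorProduct.tprod R b) := rfl

theorem symNorm_tensorDiag (b : Module.Basis (Fin d) R C) (c : C) :
    symNorm b (tensorDiag R d c) = Algebra.norm R c := by
  have h : (tensorDiag R d c : ⨂[R] _ : Fin d, C) * PiTensorProduct.tprod R b
      = PiTensorProduct.tprod R (fun i => Algebra.lmul R C c (b i)) := by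
    simp only [tensorDiag, PiTensorProduct.tprod_mul_tprod]; rfl
  have h2 := b.det_comp (Algebra.lmul R C c) b
  rw [b.det_self, mul_one] at h2
  rw [symNorm_apply, h, detForm_tprod, Algebra.norm_apply]
  exact h2

end Norm
/-! ### The loop ring -/

section Loop

open IsLocalRing

variable (k O : Type*) [Field k] [CommRing O] [IsLocalRing O] [Algebra k O]

/-- The finite levels `A ⊗_k O/𝔪ⁿ`. -/
abbrev Level (A : Type*) [CommRing A] [Algebra k A] (n : ℕ) : Type _ :=
  A ⊗[k] (O ⧸ maximalIdeal O ^ n)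

/-- The transition map `A ⊗_k O/𝔪ⁿ⁺¹ → A ⊗_k O/𝔪ⁿ`. -/
def levelTrans (A : Type*) [CommRing A] [Algebra k A] (n : ℕ) :
    Level k O A (n + 1) →ₐ[k] Level k O A n :=
  Algebra.TensorProduct.map (AlgHom.id k A)
    (Ideal.Quotient.factorₐ k (Ideal.pow_le_pow_right n.le_succ))

/-- `𝕆(A) = lim_n A ⊗_k O/𝔪ⁿ`, as the ring of compatible families. -/
def intLoop (A : Type*) [CommRing A] [Algebra k A] : Subring (∀ n : ℕ, Level k O A n) where
  carrier := {x | ∀ n, levelTrans k O A n (x (n + 1)) = x n}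
  mul_mem' hx hy n := by
    simp only [Set.mem_ofPred_eq] at hx hy
    simp [hx n, hy n]
  one_mem' n := by simp
  add_mem' hx hy n := by
    simp only [Set.mem_ofPred_eq] at hx hy
    simp [hx n, hy n]
  zero_mem' n := by simp
  neg_mem' hx n := by
    simp only [Set.mem_ofPred_eq] at hx
    simp [hx n]

/-- The structure homomorphism `O → 𝕆(A)`, `a ↦ (1 ⊗ a mod 𝔪ⁿ)_n`. -/
def intLoopStr (A : Type*) [CommRing A] [Algebra k A] : O →+* intLoop k O A :=
  (RingHom.pi fun n => (Algebra.TensorProduct.includeRight :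
      (O ⧸ maximalIdeal O ^ n) →ₐ[k] Level k O A n).toRingHom.comp
        (Ideal.Quotient.mk _)).codRestrict (intLoop k O A) fun a n => by
    change levelTrans k O A n (1 ⊗ₜ[k] Ideal.Quotient.mk _ a) = 1 ⊗ₜ[k] Ideal.Quotient.mk _ a
    simp [levelTrans]

instance (A : Type*) [CommRing A] [Algebra k A] : Algebra O (intLoop k O A) :=
  (intLoopStr k O A).toAlgebra

theorem intLoop_algebraMap_coe (A : Type*) [CommRing A] [Algebra k A] (a : O) (n : ℕ) :
    (algebraMap O (intLoop k O A) a : ∀ n, Level k O A n) n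
      = 1 ⊗ₜ[k] Ideal.Quotient.mk (maximalIdeal O ^ n) a := rfl

/-- Functoriality of the finite levels. -/
def levelMap {A B : Type*} [CommRing A] [Algebra k A] [CommRing B] [Algebra k B]
    (f : A →ₐ[k] B) (n : ℕ) : Level k O A n →ₐ[k] Level k O B n :=
  Algebra.TensorProduct.map f (AlgHom.id k _)

theorem levelTrans_levelMap {A B : Type*} [CommRing A] [Algebra k A] [CommRing B] [Algebra k B]
    (f : A →ₐ[k] B) (n : ℕ) (x : Level k O A (n + 1)) :
    levelTrans k O B n (levelMap k O f (n + 1) x) = levelMap k O f n (levelTrans k O A n x) := by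
  induction x using TensorProduct.induction_on with
  | zero => simp
  | tmul a b => simp [levelTrans, levelMap]
  | add x y hx hy => simp [hx, hy]

/-- Functoriality of `𝕆`. -/
def intLoopMap {A B : Type*} [CommRing A] [Algebra k A] [CommRing B] [Algebra k B]
    (f : A →ₐ[k] B) : intLoop k O A →ₐ[O] intLoop k O B where
  toRingHom :=
    ((RingHom.pi fun n => (levelMap k O f n).toRingHom.comp (Pi.evalRingHom _ n)).comp
      (intLoop k O A).subtype).codRestrict (intLoop k O B) fun x n => by
        change levelTrans k O B n (levelMap k O f (n + 1) (x.1 (n + 1))) = levelMap k O f n (x.1 n)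
        rw [levelTrans_levelMap, x.2 n]
  commutes' a := by
    ext n
    change levelMap k O f n (1 ⊗ₜ[k] Ideal.Quotient.mk _ a) = 1 ⊗ₜ[k] Ideal.Quotient.mk _ a
    simp [levelMap]

theorem intLoopMap_coe {A B : Type*} [CommRing A] [Algebra k A] [CommRing B] [Algebra k B]
    (f : A →ₐ[k] B) (x : intLoop k O A) (n : ℕ) :
    (intLoopMap k O f x : ∀ n, Level k O B n) n
      = levelMap k O f n ((x : ∀ n, Level k O A n) n) := rfl

theorem intLoopMap_id (A : Type*) [CommRing A] [Algebra k A] :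
    intLoopMap k O (AlgHom.id k A) = AlgHom.id O _ := by
  ext x n
  simp [intLoopMap_coe, levelMap]

theorem intLoopMap_comp {A B C : Type*} [CommRing A] [Algebra k A] [CommRing B] [Algebra k B]
    [CommRing C] [Algebra k C] (f : A →ₐ[k] B) (g : B →ₐ[k] C) :
    intLoopMap k O (g.comp f) = (intLoopMap k O g).comp (intLoopMap k O f) := by
  ext x n
  simp only [AlgHom.comp_apply, intLoopMap_coe]
  generalize (x : ∀ n, Level k O A n) n = y
  induction y using TensorProduct.induction_on with
  | zero => simp
  | tmul a b => simp [levelMap]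
  | add x y hx hy => simp [hx, hy]

variable (L : Type*) [CommRing L] [Algebra O L]

/-- The loop ring `𝕃(A) = 𝕆(A) ⊗_O L`. -/
def LoopRing (A : Type*) [CommRing A] [Algebra k A] : Type _ := intLoop k O A ⊗[O] L

instance (A : Type*) [CommRing A] [Algebra k A] : CommRing (LoopRing k O L A) :=
  inferInstanceAs (CommRing (intLoop k O A ⊗[O] L))

/-- The element `x ⊗ l` of `𝕃(A) = 𝕆(A) ⊗_O L`. -/
def loopTmul {A : Type*} [CommRing A] [Algebra k A] (x : intLoop k O A) (l : L) :
    LoopRing k O L A := x ⊗ₜ l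

/-- Functoriality of `𝕃`. -/
def loopMap {A B : Type*} [CommRing A] [Algebra k A] [CommRing B] [Algebra k B]
    (f : A →ₐ[k] B) : LoopRing k O L A →+* LoopRing k O L B :=
  (Algebra.TensorProduct.map (intLoopMap k O f) (AlgHom.id O L)).toRingHom

theorem loopMap_tmul {A B : Type*} [CommRing A] [Algebra k A] [CommRing B] [Algebra k B]
    (f : A →ₐ[k] B) (x : intLoop k O A) (l : L) :
    loopMap k O L f (loopTmul k O L x l) = loopTmul k O L (intLoopMap k O f x) l :=
  Algebra.TensorProduct.map_tmul _ _ _ _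

theorem loopRing_hom_ext {A : Type*} [CommRing A] [Algebra k A] {S : Type*} [CommRing S]
    {f g : LoopRing k O L A →+* S}
    (h : ∀ x l, f (loopTmul k O L x l) = g (loopTmul k O L x l)) : f = g := by
  refine RingHom.ext fun x => ?_
  induction x using TensorProduct.induction_on with
  | zero => exact (map_zero f).trans (map_zero g).symm
  | tmul a b => exact h a b
  | add x y hx hy => exact (map_add f _ _).trans ((congr_arg₂ (· + ·) hx hy).trans
      (map_add g _ _).symm)

theorem loopMap_id (A : Type*) [CommRing A] [Algebra k A] :
    loopMap k O L (AlgHom.id k A) = RingHom.id _ :=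
  loopRing_hom_ext k O L fun x l => by
    rw [loopMap_tmul, intLoopMap_id]
    rfl

theorem loopMap_comp {A B C : Type*} [CommRing A] [Algebra k A] [CommRing B] [Algebra k B]
    [CommRing C] [Algebra k C] (f : A →ₐ[k] B) (g : B →ₐ[k] C) :
    loopMap k O L (g.comp f) = (loopMap k O L g).comp (loopMap k O L f) :=
  loopRing_hom_ext k O L fun x l => by
    rw [loopMap_tmul, intLoopMap_comp, RingHom.comp_apply, loopMap_tmul, loopMap_tmul]
    rfl

end Loop

/-! ### The identification of `𝕃(A)` with `A((Π))` -/

section Laurent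

open IsLocalRing PowerSeries

/-- The composition of `k → O` with the reduction map to the residue field of `O` is bijective,
i.e. `k` is the residue field of `O`. -/
class HasResidueField (k O : Type*) [Field k] [CommRing O] [IsLocalRing O] [Algebra k O] :
    Prop where
  bijective : Function.Bijective (algebraMap k (ResidueField O))

variable {k O : Type*} [Field k] [CommRing O] [IsDomain O] [IsDiscreteValuationRing O]
  [Algebra k O]

theorem mem_maximalIdeal_pow {ϖ : O} (hϖ : Irreducible ϖ) (n : ℕ) (x : O) :
    x ∈ maximalIdeal O ^ n ↔ ϖ ^ n ∣ x := by
  rw [hϖ.maximalIdeal_eq, Ideal.span_singleton_pow, Ideal.mem_span_singleton]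

theorem dvd_sum_eq_zero {ϖ : O} (hϖ : Irreducible ϖ) (n : ℕ) (g : ℕ → k)
    (h : ϖ ^ n ∣ ∑ i ∈ Finset.range n, algebraMap k O (g i) * ϖ ^ i) : ∀ i < n, g i = 0 := by
  induction n generalizing g with
  | zero => simp
  | succ n ih =>
    have hs : ∑ i ∈ Finset.range (n + 1), algebraMap k O (g i) * ϖ ^ i
        = ϖ * (∑ i ∈ Finset.range n, algebraMap k O (g (i + 1)) * ϖ ^ i)
          + algebraMap k O (g 0) := by
      rw [Finset.sum_range_succ', Finset.mul_sum]
      simp only [pow_zero, mul_one]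
      congr 1
      exact Finset.sum_congr rfl fun i _ => by ring
    rw [hs] at h
    have h0 : g 0 = 0 := by
      by_contra hne
      have hd : ϖ ∣ algebraMap k O (g 0) :=
        (dvd_add_right (dvd_mul_right ϖ _)).1 ((dvd_pow_self ϖ n.succ_ne_zero).trans h)
      exact hϖ.not_isUnit (isUnit_of_dvd_unit hd ((isUnit_iff_ne_zero.2 hne).map (algebraMap k O)))
    rw [h0, map_zero, add_zero, pow_succ', mul_dvd_mul_iff_left hϖ.ne_zero] at h
    intro i hi
    rcases i with _ | i
    · exact h0
    · exact ih (fun i => g (i + 1)) h i (by omega)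

theorem exists_approx [HasResidueField k O] {ϖ : O} (hϖ : Irreducible ϖ) (n : ℕ) (x : O) :
    ∃ g : ℕ → k, ϖ ^ n ∣ x - ∑ i ∈ Finset.range n, algebraMap k O (g i) * ϖ ^ i := by
  induction n generalizing x with
  | zero => exact ⟨0, by simp⟩
  | succ n ih =>
    obtain ⟨a, ha⟩ := (HasResidueField.bijective (k := k) (O := O)).2 (residue O x)
    have hd : ϖ ∣ x - algebraMap k O a := by
      have : x - algebraMap k O a ∈ maximalIdeal O := by
        rw [← residue_eq_zero_iff, map_sub, ← ha]
        exact sub_self _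
      rwa [hϖ.maximalIdeal_eq, Ideal.mem_span_singleton] at this
    obtain ⟨y, hy⟩ := hd
    obtain ⟨g, hg⟩ := ih y
    refine ⟨fun i => Nat.casesOn i a g, ?_⟩
    have hs : x - ∑ i ∈ Finset.range (n + 1),
        algebraMap k O ((fun i => Nat.casesOn i a g : ℕ → k) i) * ϖ ^ i
        = ϖ * (y - ∑ i ∈ Finset.range n, algebraMap k O (g i) * ϖ ^ i) := by
      rw [Finset.sum_range_succ', mul_sub, ← hy, Finset.mul_sum]
      simp only [pow_zero, mul_one]
      rw [add_comm, ← sub_sub]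
      congr 1
      exact Finset.sum_congr rfl fun i _ => by ring
    rw [hs, pow_succ']
    exact mul_dvd_mul_left ϖ hg

/-- The `k`-basis `1, ϖ, …, ϖⁿ⁻¹` of `O/𝔪ⁿ`. -/
def levelBasis [HasResidueField k O] {ϖ : O} (hϖ : Irreducible ϖ) (n : ℕ) :
    Module.Basis (Fin n) k (O ⧸ maximalIdeal O ^ n) :=
  Module.Basis.mk (v := fun i : Fin n => Ideal.Quotient.mk (maximalIdeal O ^ n) (ϖ ^ (i : ℕ)))
    (by
      rw [Fintype.linearIndependent_iff]
      intro g hg i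
      have := dvd_sum_eq_zero hϖ n (fun i => if h : i < n then g ⟨i, h⟩ else 0) (by
        rw [← mem_maximalIdeal_pow hϖ, ← Ideal.Quotient.eq_zero_iff_mem, ← hg, map_sum,
          Finset.sum_range]
        refine Finset.sum_congr rfl fun i _ => ?_
        rw [Algebra.smul_def, map_mul]
        simp only [Fin.is_lt, dite_true, Fin.eta]
        rfl) i i.2
      simpa using this)
    (by
      rintro x -
      obtain ⟨x, rfl⟩ := Ideal.Quotient.mk_surjective x
      obtain ⟨g, hg⟩ := exists_approx (k := k) hϖ n x
      rw [← mem_maximalIdeal_pow hϖ, ← Ideal.Quotient.eq_zero_iff_mem, map_sub, sub_eq_zero] at hg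
      rw [hg, map_sum, Finset.sum_range]
      refine Submodule.sum_mem _ fun i _ => ?_
      have : Ideal.Quotient.mk (maximalIdeal O ^ n) (algebraMap k O (g i) * ϖ ^ (i : ℕ))
          = g i • Ideal.Quotient.mk (maximalIdeal O ^ n) (ϖ ^ (i : ℕ)) := by
        rw [Algebra.smul_def, map_mul]; rfl
      rw [this]
      exact Submodule.smul_mem _ _ (Submodule.subset_span ⟨i, rfl⟩))

variable {A : Type*} [CommRing A] [Algebra k A]

theorem levelSum_eq [HasResidueField k O] {ϖ : O} (hϖ : Irreducible ϖ) (n : ℕ) (a : ℕ → A) :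
    ∑ i ∈ Finset.range n, a i ⊗ₜ[k] Ideal.Quotient.mk (maximalIdeal O ^ n) (ϖ ^ i)
      = (Algebra.TensorProduct.basis A (levelBasis (k := k) hϖ n)).equivFun.symm
          (fun i => a i) := by
  rw [Module.Basis.equivFun_symm_apply, Finset.sum_range]
  refine Finset.sum_congr rfl fun i _ => ?_
  rw [Algebra.TensorProduct.basis_apply, TensorProduct.smul_tmul', smul_eq_mul, mul_one]
  simp [levelBasis]

theorem levelSum_inj [HasResidueField k O] {ϖ : O} (hϖ : Irreducible ϖ) (n : ℕ) (a b : ℕ → A)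
    (h : ∑ i ∈ Finset.range n, a i ⊗ₜ[k] Ideal.Quotient.mk (maximalIdeal O ^ n) (ϖ ^ i)
      = ∑ i ∈ Finset.range n, b i ⊗ₜ[k] Ideal.Quotient.mk (maximalIdeal O ^ n) (ϖ ^ i)) :
    ∀ i < n, a i = b i := by
  rw [levelSum_eq hϖ, levelSum_eq hϖ, EmbeddingLike.apply_eq_iff_eq] at h
  exact fun i hi => congr_fun h ⟨i, hi⟩

theorem exists_levelSum [HasResidueField k O] {ϖ : O} (hϖ : Irreducible ϖ) (n : ℕ)
    (x : Level k O A n) : ∃ a : ℕ → A,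
      x = ∑ i ∈ Finset.range n, a i ⊗ₜ[k] Ideal.Quotient.mk (maximalIdeal O ^ n) (ϖ ^ i) := by
  refine ⟨fun i => if h : i < n then
    (Algebra.TensorProduct.basis A (levelBasis (k := k) hϖ n)).equivFun x ⟨i, h⟩ else 0, ?_⟩
  rw [levelSum_eq hϖ]
  refine ((LinearEquiv.symm_apply_eq _).2 ?_).symm
  funext i
  simp

variable (k A) in
/-- The evaluation `A[X] → A ⊗_k O/𝔪ⁿ`, `X ↦ ϖ`. -/
def levelEval (ϖ : O) (n : ℕ) : Polynomial A →+* Level k O A n :=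
  Polynomial.eval₂RingHom
    (Algebra.TensorProduct.includeLeft : A →ₐ[k] Level k O A n).toRingHom
    (1 ⊗ₜ Ideal.Quotient.mk _ ϖ)

theorem levelEval_trunc (ϖ : O) (n m : ℕ) (f : A⟦X⟧) :
    levelEval k A ϖ n (trunc m f)
      = ∑ i ∈ Finset.range m, coeff i f ⊗ₜ[k] Ideal.Quotient.mk (maximalIdeal O ^ n) (ϖ ^ i) := by
  rw [levelEval, Polynomial.coe_eval₂RingHom, eval₂_trunc_eq_sum_range]
  simp [Algebra.TensorProduct.tmul_pow, Algebra.TensorProduct.tmul_mul_tmul]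

theorem levelEval_trunc_coe {ϖ : O} (hϖ : Irreducible ϖ) (n : ℕ) (p : Polynomial A) :
    levelEval k A ϖ n (trunc n (p : A⟦X⟧)) = levelEval k A ϖ n p := by
  have hX : levelEval k A ϖ n (Polynomial.X ^ n) = 0 := by
    have : Ideal.Quotient.mk (maximalIdeal O ^ n) (ϖ ^ n) = 0 := by
      rw [Ideal.Quotient.eq_zero_iff_mem, mem_maximalIdeal_pow hϖ]
    simp only [levelEval, Polynomial.coe_eval₂RingHom, Polynomial.eval₂_X_pow,
      Algebra.TensorProduct.tmul_pow, one_pow]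
    rw [← map_pow, this, TensorProduct.tmul_zero]
  have hd : Polynomial.X ^ n ∣ trunc n (p : A⟦X⟧) - p := by
    rw [Polynomial.X_pow_dvd_iff]
    intro i hi
    simp [coeff_trunc, hi]
  obtain ⟨q, hq⟩ := hd
  rw [← sub_eq_zero, ← map_sub, hq, map_mul, hX, zero_mul]

variable (k A) in
/-- The ring homomorphism `A[[X]] → A ⊗_k O/𝔪ⁿ`, `X ↦ ϖ`. -/
def levelOfSeries {ϖ : O} (hϖ : Irreducible ϖ) (n : ℕ) : A⟦X⟧ →+* Level k O A n where
  toFun f := levelEval k A ϖ n (trunc n f)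
  map_one' := by
    rw [← Polynomial.coe_one, levelEval_trunc_coe hϖ, map_one]
  map_zero' := by simp
  map_add' f g := by simp
  map_mul' f g := by
    rw [← trunc_trunc_mul_trunc, ← Polynomial.coe_mul, levelEval_trunc_coe hϖ, map_mul]

theorem levelOfSeries_apply {ϖ : O} (hϖ : Irreducible ϖ) (n : ℕ) (f : A⟦X⟧) :
    levelOfSeries k A hϖ n f
      = ∑ i ∈ Finset.range n, coeff i f ⊗ₜ[k] Ideal.Quotient.mk (maximalIdeal O ^ n) (ϖ ^ i) :=
  levelEval_trunc ϖ n n f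

theorem levelTrans_sum {ϖ : O} (hϖ : Irreducible ϖ) (n : ℕ) (a : ℕ → A) :
    levelTrans k O A n (∑ i ∈ Finset.range (n + 1),
        a i ⊗ₜ[k] Ideal.Quotient.mk (maximalIdeal O ^ (n + 1)) (ϖ ^ i))
      = ∑ i ∈ Finset.range n, a i ⊗ₜ[k] Ideal.Quotient.mk (maximalIdeal O ^ n) (ϖ ^ i) := by
  have h : Ideal.Quotient.mk (maximalIdeal O ^ n) (ϖ ^ n) = 0 := by
    rw [Ideal.Quotient.eq_zero_iff_mem, mem_maximalIdeal_pow hϖ]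
  have h' : ∀ i, levelTrans k O A n
      (a i ⊗ₜ[k] Ideal.Quotient.mk (maximalIdeal O ^ (n + 1)) (ϖ ^ i))
      = a i ⊗ₜ[k] Ideal.Quotient.mk (maximalIdeal O ^ n) (ϖ ^ i) := fun i => by
    simp [levelTrans]
  rw [map_sum, Finset.sum_range_succ, h', h, TensorProduct.tmul_zero, add_zero]
  exact Finset.sum_congr rfl fun i _ => h' i

variable (k A) in
/-- The ring homomorphism `A[[X]] → 𝕆(A)`, `X ↦ ϖ`. -/
def seriesHom {ϖ : O} (hϖ : Irreducible ϖ) : A⟦X⟧ →+* intLoop k O A :=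
  (RingHom.pi fun n => levelOfSeries k A hϖ n).codRestrict (intLoop k O A) fun f n => by
    change levelTrans k O A n (levelOfSeries k A hϖ (n + 1) f) = levelOfSeries k A hϖ n f
    rw [levelOfSeries_apply, levelOfSeries_apply, levelTrans_sum hϖ]

theorem seriesHom_coe {ϖ : O} (hϖ : Irreducible ϖ) (f : A⟦X⟧) (n : ℕ) :
    (seriesHom k A hϖ f : ∀ n, Level k O A n) n
      = ∑ i ∈ Finset.range n, coeff i f ⊗ₜ[k] Ideal.Quotient.mk (maximalIdeal O ^ n) (ϖ ^ i) :=
  levelOfSeries_apply hϖ n f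

theorem seriesHom_bijective [HasResidueField k O] {ϖ : O} (hϖ : Irreducible ϖ) :
    Function.Bijective (seriesHom k A hϖ) := by
  constructor
  · intro f g hfg
    ext i
    have h := congr_fun (congr_arg Subtype.val hfg) (i + 1)
    rw [seriesHom_coe, seriesHom_coe] at h
    exact levelSum_inj hϖ (i + 1) (fun i => coeff i f) (fun i => coeff i g) h i i.lt_succ_self
  · intro x
    choose a ha using fun n => exists_levelSum (k := k) (A := A) hϖ n
      ((x : ∀ n, Level k O A n) n)
    have hstep : ∀ n, ∀ i < n, a (n + 1) i = a n i := fun n => by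
      refine levelSum_inj (k := k) hϖ n _ _ ?_
      rw [← ha n, ← levelTrans_sum hϖ, ← ha (n + 1)]
      exact x.2 n
    have hcoef : ∀ n, ∀ i < n, a n i = a (i + 1) i := by
      intro n i hi
      induction n, (show i + 1 ≤ n from hi) using Nat.le_induction with
      | base => rfl
      | succ m hm ih => rw [hstep m i hm, ih hm]
    refine ⟨PowerSeries.mk fun i => a (i + 1) i, Subtype.ext (funext fun n => ?_)⟩
    rw [seriesHom_coe, ha n]
    refine Finset.sum_congr rfl fun i hi => ?_
    rw [coeff_mk, hcoef n i (Finset.mem_range.1 hi)]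

theorem seriesHom_X {ϖ : O} (hϖ : Irreducible ϖ) :
    seriesHom k A hϖ X = algebraMap O (intLoop k O A) ϖ := by
  refine Subtype.ext (funext fun n => ?_)
  rw [intLoop_algebraMap_coe]
  change levelEval k A ϖ n (trunc n (X : A⟦X⟧)) = _
  rw [← Polynomial.coe_X, levelEval_trunc_coe hϖ]
  simp [levelEval]

theorem seriesHom_map {ϖ : O} (hϖ : Irreducible ϖ) {B : Type*} [CommRing B] [Algebra k B]
    (f : A →ₐ[k] B) (s : A⟦X⟧) :
    intLoopMap k O f (seriesHom k A hϖ s) = seriesHom k B hϖ (PowerSeries.map f s) := by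
  refine Subtype.ext (funext fun n => ?_)
  rw [intLoopMap_coe, seriesHom_coe, seriesHom_coe, map_sum]
  exact Finset.sum_congr rfl fun i _ => by simp [levelMap]

variable (k A) in
/-- The isomorphism `A[[X]] ≅ 𝕆(A)`, `X ↦ ϖ`. -/
def seriesEquiv [HasResidueField k O] {ϖ : O} (hϖ : Irreducible ϖ) : A⟦X⟧ ≃+* intLoop k O A :=
  RingEquiv.ofBijective (seriesHom k A hϖ) (seriesHom_bijective hϖ)

variable (L : Type*) [Field L] [Algebra O L] [IsFractionRing O L]

theorem isLocalization_powers {ϖ : O} (hϖ : Irreducible ϖ) :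
    IsLocalization (Submonoid.powers ϖ) L where
  map_units := by
    rintro ⟨_, n, rfl⟩
    have : algebraMap O L (ϖ ^ n) ≠ 0 :=
      (map_ne_zero_iff _ (IsFractionRing.injective O L)).2 (pow_ne_zero n hϖ.ne_zero)
    exact isUnit_iff_ne_zero.2 this
  surj z := by
    obtain ⟨a, b, hb, rfl⟩ := IsFractionRing.div_surjective (A := O) z
    have hb0 : b ≠ 0 := nonZeroDivisors.ne_zero hb
    obtain ⟨n, u, hu⟩ := IsDiscreteValuationRing.eq_unit_mul_pow_irreducible hb0 hϖ
    refine ⟨(((u⁻¹ : Oˣ) : O) * a, ⟨ϖ ^ n, n, rfl⟩), ?_⟩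
    have hb' : algebraMap O L b ≠ 0 := (map_ne_zero_iff _ (IsFractionRing.injective O L)).2 hb0
    have h1 : ϖ ^ n = ((u⁻¹ : Oˣ) : O) * b := by rw [hu]; simp
    change algebraMap O L a / algebraMap O L b * algebraMap O L (ϖ ^ n)
      = algebraMap O L (((u⁻¹ : Oˣ) : O) * a)
    rw [h1, map_mul, map_mul]
    field_simp
  exists_of_eq h := ⟨1, by rw [IsFractionRing.injective O L h]⟩

theorem isLocalization_loopRing {ϖ : O} (hϖ : Irreducible ϖ) :
    IsLocalization (Algebra.algebraMapSubmonoid (intLoop k O A) (Submonoid.powers ϖ))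
      (intLoop k O A ⊗[O] L) := by
  have := isLocalization_powers L hϖ
  exact IsLocalization.tensor L (Submonoid.powers ϖ)

variable (k A) in
/-- The isomorphism `A((Π)) ≅ 𝕃(A)` sending `Π` to (the image of) the uniformizer `ϖ`, through
which `𝕃(A)` is described as a ring of Laurent series. -/
def laurentEquiv [HasResidueField k O] {ϖ : O} (hϖ : Irreducible ϖ) :
    LaurentSeries A ≃+* LoopRing k O L A :=
  haveI := isLocalization_loopRing (k := k) (A := A) L hϖ
  IsLocalization.ringEquivOfRingEquiv (M := Submonoid.powers (X : A⟦X⟧))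
    (T := Algebra.algebraMapSubmonoid (intLoop k O A) (Submonoid.powers ϖ))
    (LaurentSeries A) (intLoop k O A ⊗[O] L) (seriesEquiv k A hϖ) (by
      rw [Algebra.algebraMapSubmonoid, Submonoid.map_powers, Submonoid.map_powers]
      congr 1
      exact seriesHom_X hϖ)

theorem laurentEquiv_series [HasResidueField k O] {ϖ : O} (hϖ : Irreducible ϖ) (s : A⟦X⟧) :
    laurentEquiv k A L hϖ (HahnSeries.ofPowerSeries ℤ A s)
      = loopTmul k O L (seriesHom k A hϖ s) 1 := by
  have := isLocalization_loopRing (k := k) (A := A) L hϖ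
  exact IsLocalization.ringEquivOfRingEquiv_eq (Q := intLoop k O A ⊗[O] L) _ s

/-- The series `Π` corresponds to the uniformizer. -/
theorem laurentEquiv_X [HasResidueField k O] {ϖ : O} (hϖ : Irreducible ϖ) :
    laurentEquiv k A L hϖ (HahnSeries.single 1 1) = loopTmul k O L 1 (algebraMap O L ϖ) := by
  rw [← HahnSeries.ofPowerSeries_X, laurentEquiv_series, seriesHom_X, loopTmul, loopTmul,
    Algebra.algebraMap_eq_smul_one, TensorProduct.smul_tmul, Algebra.algebraMap_eq_smul_one]

/-- The homomorphism `A((Π)) → B((Π))` induced by `A → B` on coefficients. -/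
def laurentMap {A B : Type*} [CommRing A] [CommRing B] (f : A →+* B) :
    LaurentSeries A →+* LaurentSeries B where
  toFun s := HahnSeries.map s f
  map_one' := HahnSeries.map_one f.toMonoidWithZeroHom
  map_mul' _ _ := HahnSeries.map_mul (f : A →ₙ+* B)
  map_zero' := HahnSeries.map_zero f.toZeroHom
  map_add' _ _ := HahnSeries.map_add f.toAddMonoidHom

theorem laurentMap_coeff {A B : Type*} [CommRing A] [CommRing B] (f : A →+* B)
    (s : LaurentSeries A) (n : ℤ) : (laurentMap f s).coeff n = f (s.coeff n) := rfl

theorem laurentMap_series {A B : Type*} [CommRing A] [CommRing B] (f : A →+* B) (s : A⟦X⟧) :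
    laurentMap f (HahnSeries.ofPowerSeries ℤ A s)
      = HahnSeries.ofPowerSeries ℤ B (PowerSeries.map f s) := by
  ext n
  rw [laurentMap_coeff]
  by_cases hn : 0 ≤ n
  · lift n to ℕ using hn
    simp
  · rw [HahnSeries.ofPowerSeries_apply, HahnSeries.ofPowerSeries_apply,
      HahnSeries.embDomain_of_notMem_range, HahnSeries.embDomain_of_notMem_range, map_zero] <;>
    · rintro ⟨m, rfl⟩
      exact hn (by simp)

/-- The identification of `𝕃(A)` with `A((Π))` is natural in `A`. -/
theorem laurentEquiv_map [HasResidueField k O] {ϖ : O} (hϖ : Irreducible ϖ) {B : Type*}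
    [CommRing B] [Algebra k B] (f : A →ₐ[k] B) (s : LaurentSeries A) :
    loopMap k O L f (laurentEquiv k A L hϖ s)
      = laurentEquiv k B L hϖ (laurentMap (f : A →+* B) s) := by
  have : (loopMap k O L f).comp (laurentEquiv k A L hϖ : LaurentSeries A →+* LoopRing k O L A)
      = (laurentEquiv k B L hϖ : LaurentSeries B →+* LoopRing k O L B).comp
        (laurentMap (f : A →+* B)) := by
    refine IsLocalization.ringHom_ext (Submonoid.powers (X : A⟦X⟧)) (RingHom.ext fun t => ?_)
    simp only [RingHom.comp_apply, LaurentSeries.coe_algebraMap, RingHom.coe_coe,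
      laurentEquiv_series, laurentMap_series, loopMap_tmul, seriesHom_map]
  exact DFunLike.congr_fun this s

theorem exists_laurent_lift {A B : Type*} [CommRing A] [CommRing B] (f : A →+* B)
    (hf : Function.Injective f) (s : LaurentSeries B) (hs : ∀ n, s.coeff n ∈ f.range) :
    ∃ t : LaurentSeries A, laurentMap f t = s := by
  choose c hc using hs
  refine ⟨⟨c, s.isPWO_support.mono fun n hn => ?_⟩, ?_⟩
  · intro h
    apply hn
    apply hf
    rw [hc, h, map_zero]
  · ext n
    exact hc n

theorem loopMap_injective [HasResidueField k O] {B : Type*}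
    [CommRing B] [Algebra k B] (f : A →ₐ[k] B) (hf : Function.Injective f) :
    Function.Injective (loopMap k O L f) := by
  obtain ⟨ϖ, hϖ⟩ := IsDiscreteValuationRing.exists_irreducible O
  intro x y h
  obtain ⟨s, rfl⟩ := (laurentEquiv k A L hϖ).surjective x
  obtain ⟨t, rfl⟩ := (laurentEquiv k A L hϖ).surjective y
  rw [laurentEquiv_map, laurentEquiv_map, EmbeddingLike.apply_eq_iff_eq] at h
  congr 1
  ext n
  exact hf (congr_arg (fun s => HahnSeries.coeff s n) h)

end Laurent

/-! ### The relative symmetric power of `Spec L` over two bases -/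

section Restrict

variable (k K L : Type*) [CommRing k] [CommRing K] [CommRing L] [Algebra k K] [Algebra K L]
  [Algebra k L] [IsScalarTower k K L] (d : ℕ)

/-- The homomorphism `L ⊗_k ⋯ ⊗_k L → L ⊗_K ⋯ ⊗_K L`. -/
def tensorBaseHom : (⨂[k] _ : Fin d, L) →ₐ[k] (⨂[K] _ : Fin d, L) :=
  PiTensorProduct.liftAlgHom
    ((PiTensorProduct.tprod K (s := fun _ : Fin d => L)).restrictScalars k)
    rfl
    (fun x y => by simp [PiTensorProduct.tprod_mul_tprod])

theorem tensorBaseHom_tprod (x : Fin d → L) :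
    tensorBaseHom k K L d (PiTensorProduct.tprod k x) = PiTensorProduct.tprod K x := by
  exact PiTensorProduct.lift.tprod (R := k) x

/-- The homomorphism `TS^d_k(L) → TS^d_K(L)` giving `Sym^d_K(Spec L) → Sym^d_k(Spec L)`. -/
def symBaseHom : symTensors k d L →ₐ[k] symTensors K d L :=
  ((tensorBaseHom k K L d).comp (symTensors k d L).val).codRestrict
    ((symTensors K d L).restrictScalars k) fun t => by
      change tensorBaseHom k K L d t ∈ symTensors K d L
      rw [mem_symTensors]
      intro σ
      have h : ((permHom K d L σ).restrictScalars k).comp (tensorBaseHom k K L d)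
          = (tensorBaseHom k K L d).comp (permHom k d L σ) :=
        tensorAlgHom_ext k d fun x => by
          simp [permHom_tprod, tensorBaseHom_tprod]
      have h2 := DFunLike.congr_fun h (t : ⨂[k] _ : Fin d, L)
      simp only [AlgHom.comp_apply, AlgHom.restrictScalars_apply] at h2
      rw [h2, (mem_symTensors k d _).1 t.2 σ]

theorem symBaseHom_coe (t : symTensors k d L) :
    (symBaseHom k K L d t : ⨂[K] _ : Fin d, L) = tensorBaseHom k K L d t := rfl

end Restrict

/-! ### Functors of points and symmetric powers

Affine `k`-schemes and ind-`k`-schemes are represented by the functors which they define on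
`k`-algebras. -/

section Functors

variable {k : Type u} [CommRing k]

/-- The functor of points of `Spec B`. -/
abbrev specFunctor (k : Type u) [CommRing k] (B : Type u) [CommRing B] [Algebra k B] :
    CommAlgCat.{u} k ⥤ Type (u + 1) :=
  uliftCoyoneda.{u + 1}.obj (Opposite.op (CommAlgCat.of k B))

/-- The morphism `Spec C → Spec B` defined by `f : B → C`. -/
abbrev specMap {B C : Type u} [CommRing B] [Algebra k B] [CommRing C] [Algebra k C]
    (f : B →ₐ[k] C) : specFunctor k C ⟶ specFunctor k B :=
  uliftCoyoneda.{u + 1}.map (CommAlgCat.ofHom f).op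

/-- The morphism `Spec B → F` corresponding to a `B`-point of `F`. -/
abbrev ofPoint {B : Type u} [CommRing B] [Algebra k B] {F : CommAlgCat.{u} k ⥤ Type (u + 1)}
    (x : F.obj (CommAlgCat.of k B)) : specFunctor k B ⟶ F :=
  uliftCoyonedaEquiv.{u + 1}.symm x

variable (d : ℕ)

/-- An `A`-point of `Spec TS^d_k(B)` for a morphism `Spec B → F`. -/
structure PreSymPoint (F : CommAlgCat.{u} k ⥤ Type (u + 1)) (A : CommAlgCat.{u} k) :
    Type (u + 1) where
  /-- The affine scheme `Spec B`. -/
  alg : CommAlgCat.{u} k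
  /-- The morphism `Spec B → F`. -/
  point : F.obj alg
  /-- The morphism `Spec A → Spec TS^d_k(B)`. -/
  hom : symTensors k d alg →ₐ[k] A

/-- The identifications between the points of the schemes `Spec TS^d_k(B)` given by the morphisms
`Spec C → Spec B` over `F`. -/
inductive SymRel (F : CommAlgCat.{u} k ⥤ Type (u + 1)) (A : CommAlgCat.{u} k) :
    PreSymPoint d F A → PreSymPoint d F A → Prop
  | of {B C : CommAlgCat.{u} k} (h : B ⟶ C) (x : F.obj B) (g : symTensors k d C →ₐ[k] A) :
    SymRel F A ⟨B, x, g.comp (symTensorsMap k d h.hom)⟩ ⟨C, F.map h x, g⟩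

/-- The symmetric power `Sym^d_k(F)` of an ind-affine `k`-scheme `F`: the colimit of
`Sym^d_k(Spec B) = Spec TS^d_k(B)` over all affine `k`-schemes `Spec B` with a morphism to `F`
(the left Kan extension of `Spec B ↦ Spec TS^d_k(B)`). It coincides with `Spec TS^d_k(B)` for
`F = Spec B` (see `symPowerSpecIso`), and with the filtered colimit of the schemes `Sym^d_k(X_i)`
if `F` is the filtered colimit of affine schemes `X_i`, that is, with the quotient of `F^d` by the
symmetric group in the category of ind-affine `k`-schemes. -/
def symPower (F : CommAlgCat.{u} k ⥤ Type (u + 1)) : CommAlgCat.{u} k ⥤ Type (u + 1) where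
  obj A := Quot (SymRel d F A)
  map {A A'} f := ↾(Quot.map (fun p => ⟨p.alg, p.point, f.hom.comp p.hom⟩) (by
    rintro _ _ ⟨h, x, g⟩
    exact SymRel.of h x (f.hom.comp g)))
  map_id A := by
    ext p
    induction p using Quot.ind
    rfl
  map_comp f g := by
    ext p
    induction p using Quot.ind
    rfl

/-- The morphism `Sym^d_k(η) : Sym^d_k(F) → Sym^d_k(G)` induced by `η : F → G`. -/
def symPowerMap {F G : CommAlgCat.{u} k ⥤ Type (u + 1)} (η : F ⟶ G) :
    symPower d F ⟶ symPower d G where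
  app A := ↾(Quot.map (fun p => ⟨p.alg, η.app p.alg p.point, p.hom⟩) (by
    rintro _ _ ⟨h, x, g⟩
    have hn : η.app _ (F.map h x) = G.map h (η.app _ x) := NatTrans.naturality_apply η h x
    change SymRel d G A _ ⟨_, η.app _ (F.map h x), g⟩
    rw [hn]
    exact SymRel.of h _ g))
  naturality A B f := by
    ext p
    induction p using Quot.ind
    rfl

/-- The canonical isomorphism `Spec TS^d_k(B) ≅ Sym^d_k(Spec B)`. -/
def symPowerSpecIso (B : Type u) [CommRing B] [Algebra k B] :
    specFunctor k (symTensors k d B) ≅ symPower d (specFunctor k B) :=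
  NatIso.ofComponents (fun A =>
    { hom := ↾fun g => Quot.mk _ ⟨CommAlgCat.of k B, ULift.up (𝟙 _), g.down.hom⟩
      inv := ↾(Quot.lift
        (fun p => ULift.up (CommAlgCat.ofHom (p.hom.comp (symTensorsMap k d p.point.down.hom)))) (by
          rintro _ _ ⟨h, x, g⟩
          change ULift.up (CommAlgCat.ofHom ((g.comp (symTensorsMap k d h.hom)).comp
              (symTensorsMap k d x.down.hom)))
            = ULift.up (CommAlgCat.ofHom (g.comp (symTensorsMap k d (h.hom.comp x.down.hom))))
          rw [symTensorsMap_comp]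
          rfl))
      hom_inv_id := by
        ext g
        change ULift.up (CommAlgCat.ofHom (g.down.hom.comp (symTensorsMap k d (AlgHom.id k B))))
          = g
        rw [symTensorsMap_id]
        rfl
      inv_hom_id := by
        ext p
        induction p using Quot.ind with
        | mk p =>
          obtain ⟨C, x, g⟩ := p
          change Quot.mk _ (PreSymPoint.mk (CommAlgCat.of k B) (ULift.up (𝟙 _))
            (g.comp (symTensorsMap k d x.down.hom))) = Quot.mk _ ⟨C, x, g⟩
          refine Quot.sound ?_
          have := SymRel.of (d := d) (F := specFunctor k B) x.down (ULift.up (𝟙 _)) g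
          have h2 : (specFunctor k B).map x.down (ULift.up (𝟙 _)) = x := by
            change ULift.up (𝟙 _ ≫ x.down) = x
            rw [Category.id_comp]
            rfl
          rw [h2] at this
          exact this })
    (by
      intro A A' f
      ext g
      rfl)

end Functors

/-! ### The loop group and its multiplication -/

section LoopGroup

open IsLocalRing

variable (k O L : Type u) [Field k] [CommRing O] [IsDomain O] [IsDiscreteValuationRing O]
  [Algebra k O] [Field L] [Algebra O L] [IsFractionRing O L]

/-- Functoriality of `A ↦ 𝕃(A)ˣ`. -/
def loopUnitsMap {A B : Type u} [CommRing A] [Algebra k A] [CommRing B] [Algebra k B]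
    (f : A →ₐ[k] B) : (LoopRing k O L A)ˣ →* (LoopRing k O L B)ˣ :=
  Units.map (loopMap k O L f).toMonoidHom

theorem loopUnitsMap_coe {A B : Type u} [CommRing A] [Algebra k A] [CommRing B] [Algebra k B]
    (f : A →ₐ[k] B) (x : (LoopRing k O L A)ˣ) :
    (loopUnitsMap k O L f x : LoopRing k O L B) = loopMap k O L f x := rfl

theorem loopUnitsMap_id (A : Type u) [CommRing A] [Algebra k A] (x : (LoopRing k O L A)ˣ) :
    loopUnitsMap k O L (AlgHom.id k A) x = x := by
  refine Units.ext ?_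
  rw [loopUnitsMap_coe, loopMap_id]
  rfl

theorem loopUnitsMap_comp {A B C : Type u} [CommRing A] [Algebra k A] [CommRing B] [Algebra k B]
    [CommRing C] [Algebra k C] (f : A →ₐ[k] B) (g : B →ₐ[k] C) (x : (LoopRing k O L A)ˣ) :
    loopUnitsMap k O L (g.comp f) x = loopUnitsMap k O L g (loopUnitsMap k O L f x) := by
  refine Units.ext ?_
  rw [loopUnitsMap_coe, loopMap_comp]
  rfl

/-- The loop group `𝕃ˣ : A ↦ 𝕃(A)ˣ`, as a functor on `k`-algebras. It is ind-affine: in terms of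
Laurent series it is the union over `n` of the affine schemes of pairs `(u, v)` of series with poles
of order at most `n` such that `u v = 1`. -/
def loopGroup : CommAlgCat.{u} k ⥤ Type (u + 1) where
  obj A := ULift.{u + 1} (LoopRing k O L A)ˣ
  map f := ↾fun x => ULift.up (loopUnitsMap k O L f.hom x.down)
  map_id A := by
    ext x
    exact congr_arg Units.val (loopUnitsMap_id k O L A x.down)
  map_comp f g := by
    ext x
    exact congr_arg Units.val (loopUnitsMap_comp k O L f.hom g.hom x.down)

variable (d : ℕ)

/-- The product in `𝕃ˣ(B ⊗ ⋯ ⊗ B)` of the images of `x ∈ 𝕃ˣ(B)` under the `d` coprojections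
`B → B ⊗ ⋯ ⊗ B`: if `x` is seen as a morphism `Spec B → 𝕃ˣ`, this is the composition of
`x^d : (Spec B)^d → (𝕃ˣ)^d` with the multiplication `(𝕃ˣ)^d → 𝕃ˣ`. -/
def tensorProd {B : Type u} [CommRing B] [Algebra k B] (x : (LoopRing k O L B)ˣ) :
    (LoopRing k O L (⨂[k] _ : Fin d, B))ˣ :=
  ∏ i : Fin d, loopUnitsMap k O L (PiTensorProduct.singleAlgHom (A := fun _ : Fin d => B) i) x

theorem tensorProd_map {B C : Type u} [CommRing B] [Algebra k B] [CommRing C] [Algebra k C]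
    (h : (⨂[k] _ : Fin d, B) →ₐ[k] C) (x : (LoopRing k O L B)ˣ) :
    loopUnitsMap k O L h (tensorProd k O L d x)
      = ∏ i : Fin d, loopUnitsMap k O L
          (h.comp (PiTensorProduct.singleAlgHom (A := fun _ : Fin d => B) i)) x := by
  rw [tensorProd, map_prod]
  simp only [loopUnitsMap_comp]

theorem permHom_single {B : Type u} [CommRing B] [Algebra k B] (σ : Equiv.Perm (Fin d))
    (i : Fin d) :
    (permHom k d B σ).comp (PiTensorProduct.singleAlgHom (A := fun _ : Fin d => B) i)
      = PiTensorProduct.singleAlgHom (A := fun _ : Fin d => B) (σ.symm i) := by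
  ext b
  simp only [AlgHom.comp_apply, PiTensorProduct.singleAlgHom_apply, permHom_tprod]
  congr 1
  funext j
  by_cases h : j = σ.symm i
  · subst h; simp
  · have h2 : σ j ≠ i := fun h3 => h (by rw [← h3]; simp)
    simp [Pi.mulSingle, h, h2]

theorem tensorPowMap_single {B C : Type u} [CommRing B] [Algebra k B] [CommRing C] [Algebra k C]
    (f : B →ₐ[k] C) (i : Fin d) :
    (tensorPowMap k d f).comp (PiTensorProduct.singleAlgHom (A := fun _ : Fin d => B) i)
      = (PiTensorProduct.singleAlgHom (A := fun _ : Fin d => C) i).comp f := by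
  ext b
  simp only [AlgHom.comp_apply, PiTensorProduct.singleAlgHom_apply, tensorPowMap_tprod]
  congr 1
  funext j
  by_cases h : j = i
  · subst h; simp
  · simp [Pi.mulSingle, h]

theorem tensorProd_perm {B : Type u} [CommRing B] [Algebra k B] (σ : Equiv.Perm (Fin d))
    (x : (LoopRing k O L B)ˣ) :
    loopUnitsMap k O L (permHom k d B σ) (tensorProd k O L d x) = tensorProd k O L d x := by
  rw [tensorProd_map, tensorProd]
  simp only [permHom_single]
  exact Equiv.prod_comp σ.symm fun i => loopUnitsMap k O L
    (PiTensorProduct.singleAlgHom (A := fun _ : Fin d => B) i) x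

theorem tensorProd_natural {B C : Type u} [CommRing B] [Algebra k B] [CommRing C] [Algebra k C]
    (f : B →ₐ[k] C) (x : (LoopRing k O L B)ˣ) :
    loopUnitsMap k O L (tensorPowMap k d f) (tensorProd k O L d x)
      = tensorProd k O L d (loopUnitsMap k O L f x) := by
  rw [tensorProd_map, tensorProd]
  simp only [tensorPowMap_single, loopUnitsMap_comp]

variable [HasResidueField k O]

/-- Elements of `𝕃(B ⊗ ⋯ ⊗ B)` invariant under permutations come from `𝕃(TS^d_k(B))`. -/
theorem exists_loop_descent {B : Type u} [CommRing B] [Algebra k B]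
    (y : LoopRing k O L (⨂[k] _ : Fin d, B))
    (hy : ∀ σ, loopMap k O L (permHom k d B σ) y = y) :
    ∃ z, loopMap k O L (symTensors k d B).val z = y := by
  obtain ⟨ϖ, hϖ⟩ := IsDiscreteValuationRing.exists_irreducible O
  obtain ⟨s, rfl⟩ := (laurentEquiv k (⨂[k] _ : Fin d, B) L hϖ).surjective y
  obtain ⟨t, ht⟩ := exists_laurent_lift ((symTensors k d B).val : symTensors k d B →+* _)
    Subtype.val_injective s (fun n => ⟨⟨s.coeff n, by
      rw [mem_symTensors]
      intro σ
      have h := hy σ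
      rw [laurentEquiv_map, EmbeddingLike.apply_eq_iff_eq] at h
      exact congr_arg (fun s => HahnSeries.coeff s n) h⟩, rfl⟩)
  exact ⟨laurentEquiv k _ L hϖ t, by rw [laurentEquiv_map, ht]⟩

theorem exists_symProd {B : Type u} [CommRing B] [Algebra k B] (x : (LoopRing k O L B)ˣ) :
    ∃ z : (LoopRing k O L (symTensors k d B))ˣ,
      loopUnitsMap k O L (symTensors k d B).val z = tensorProd k O L d x := by
  have hinj := loopMap_injective (k := k) (O := O) L (symTensors k d B).val Subtype.val_injective
  have hy : ∀ σ, loopMap k O L (permHom k d B σ) (tensorProd k O L d x).val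
      = (tensorProd k O L d x).val := fun σ =>
    congr_arg Units.val (tensorProd_perm k O L d σ x)
  have hy2 : ∀ σ, loopMap k O L (permHom k d B σ) (tensorProd k O L d x)⁻¹.val
      = (tensorProd k O L d x)⁻¹.val := fun σ => by
    rw [← loopUnitsMap_coe, map_inv, tensorProd_perm]
  obtain ⟨z, hz⟩ := exists_loop_descent k O L d _ hy
  obtain ⟨w, hw⟩ := exists_loop_descent k O L d _ hy2
  have h1 : z * w = 1 := hinj (by rw [map_mul, hz, hw, map_one, Units.mul_inv])
  exact ⟨⟨z, w, h1, by rw [mul_comm, h1]⟩, Units.ext hz⟩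

theorem loopUnitsMap_injective {B C : Type u} [CommRing B] [Algebra k B] [CommRing C] [Algebra k C]
    (f : B →ₐ[k] C) (hf : Function.Injective f) : Function.Injective (loopUnitsMap k O L f) :=
  fun _ _ h => Units.ext (loopMap_injective (k := k) (O := O) L f hf (congr_arg Units.val h))

/-- For `x ∈ 𝕃ˣ(B)`, the unique element of `𝕃ˣ(TS^d_k(B))` whose image in `𝕃ˣ(B ⊗ ⋯ ⊗ B)` is the
product of the images of `x` under the `d` coprojections. -/
def symProd {B : Type u} [CommRing B] [Algebra k B] (x : (LoopRing k O L B)ˣ) :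
    (LoopRing k O L (symTensors k d B))ˣ :=
  (exists_symProd k O L d x).choose

theorem symProd_spec {B : Type u} [CommRing B] [Algebra k B] (x : (LoopRing k O L B)ˣ) :
    loopUnitsMap k O L (symTensors k d B).val (symProd k O L d x) = tensorProd k O L d x :=
  (exists_symProd k O L d x).choose_spec

theorem symProd_natural {B C : Type u} [CommRing B] [Algebra k B] [CommRing C] [Algebra k C]
    (f : B →ₐ[k] C) (x : (LoopRing k O L B)ˣ) :
    loopUnitsMap k O L (symTensorsMap k d f) (symProd k O L d x)
      = symProd k O L d (loopUnitsMap k O L f x) := by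
  apply loopUnitsMap_injective k O L (symTensors k d C).val Subtype.val_injective
  rw [symProd_spec, ← tensorProd_natural, ← symProd_spec, ← loopUnitsMap_comp, ← loopUnitsMap_comp]
  rfl

/-- The multiplication `Sym^d_k(𝕃ˣ) → 𝕃ˣ`, induced by the multiplication `(𝕃ˣ)^d → 𝕃ˣ`. -/
def symMul : symPower d (loopGroup k O L) ⟶ loopGroup k O L where
  app A := ↾(Quot.lift
    (fun p => ULift.up (loopUnitsMap k O L p.hom (symProd k O L d p.point.down))) (by
      rintro _ _ ⟨h, x, g⟩
      change ULift.up (loopUnitsMap k O L (g.comp (symTensorsMap k d h.hom))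
          (symProd k O L d x.down))
        = ULift.up (loopUnitsMap k O L g (symProd k O L d (loopUnitsMap k O L h.hom x.down)))
      rw [loopUnitsMap_comp, symProd_natural]))
  naturality A A' f := by
    ext p
    induction p using Quot.ind with
    | mk p => exact congr_arg ULift.up (loopUnitsMap_comp k O L p.hom f.hom _)

/-- If `B → A` are `d` homomorphisms `f₁, …, f_d` and `x ∈ 𝕃ˣ(B)`, then the multiplication sends
the class in `Sym^d_k(𝕃ˣ)(A)` of the `d` points `f_i(x)` of `𝕃ˣ(A)` to their product. -/
theorem symMul_class {A : CommAlgCat.{u} k} (B : CommAlgCat.{u} k) (x : (LoopRing k O L B)ˣ)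
    (h : (⨂[k] _ : Fin d, B) →ₐ[k] A) :
    (symMul k O L d).app A (Quot.mk _ ⟨B, ULift.up x, h.comp (symTensors k d B).val⟩)
      = ULift.up (∏ i : Fin d, loopUnitsMap k O L
          (h.comp (PiTensorProduct.singleAlgHom (A := fun _ : Fin d => B) i)) x) := by
  rw [← tensorProd_map, ← symProd_spec, ← loopUnitsMap_comp]
  rfl

variable {k O}

/-- The element of `𝕃ˣ(F)`, for a field `F`, corresponding to a nonzero Laurent series in `Π`. -/
def laurentPoint {ϖ : O} (hϖ : Irreducible ϖ) (F : Type u) [Field F] [Algebra k F]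
    (s : LaurentSeries F) (hs : s ≠ 0) : (loopGroup k O L).obj (CommAlgCat.of k F) :=
  ULift.up (Units.map (laurentEquiv k F L hϖ : LaurentSeries F →* LoopRing k O L F)
    (Units.mk0 s hs))

variable [Algebra k L]

/-- The Laurent series `(Π - π)⁻¹ Π` over `L`. -/
def phiSeries (ϖ : O) : LaurentSeries L :=
  (HahnSeries.single 1 1 - HahnSeries.C (algebraMap O L ϖ))⁻¹ * HahnSeries.single 1 1

theorem phiSeries_ne_zero (ϖ : O) : phiSeries L ϖ ≠ 0 := by
  have h1 : (HahnSeries.single 1 1 : LaurentSeries L) ≠ 0 := by simp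
  have h2 : (HahnSeries.single 1 1 - HahnSeries.C (algebraMap O L ϖ) : LaurentSeries L) ≠ 0 := by
    intro h
    have := congr_arg (fun s => HahnSeries.coeff s 1) h
    simp [HahnSeries.C_apply] at this
  exact mul_ne_zero (inv_ne_zero h2) h1

/-- The morphism `φ : Spec L → 𝕃ˣ` corresponding to the `L`-point `(Π - π)⁻¹ Π`. -/
def phi {ϖ : O} (hϖ : Irreducible ϖ) : specFunctor k L ⟶ loopGroup k O L :=
  ofPoint (laurentPoint L hϖ L (phiSeries L ϖ) (phiSeries_ne_zero L ϖ))

/-- The Laurent series `P(Π)⁻¹ Π^d` attached to a polynomial `P`. -/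
def polySeries {F : Type u} [Field F] (P : Polynomial F) (d : ℕ) : LaurentSeries F :=
  (HahnSeries.ofPowerSeries ℤ F (P : PowerSeries F))⁻¹ * HahnSeries.single 1 1 ^ d

theorem polySeries_ne_zero {F : Type u} [Field F] {P : Polynomial F} (hP : P ≠ 0) (d : ℕ) :
    polySeries P d ≠ 0 := by
  have h1 : HahnSeries.ofPowerSeries ℤ F (P : PowerSeries F) ≠ 0 :=
    (map_ne_zero_iff _ HahnSeries.ofPowerSeries_injective).2 (by simpa using hP)
  exact mul_ne_zero (inv_ne_zero h1) (pow_ne_zero d (by simp))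

end LoopGroup

/-! ### The norm point -/

section NormPoint

variable {k : Type u} [Field k] {L : Type u} [Field L] [Algebra k L]
  (K : IntermediateField k L) [FiniteDimensional K L]

/-- The canonical morphism `ψ : Spec K → Sym^d_K(Spec L) = Spec TS^d_K(L)`, `d = [L : K]`, viewed as
a morphism of `k`-schemes. -/
def normPoint : specFunctor k K ⟶ specFunctor k (symTensors K (Module.finrank K L) L) :=
  specMap ((symNorm (Module.finBasis K L)).restrictScalars k)

/-- The canonical morphism `Sym^d_K(Spec L) → Sym^d_k(Spec L)`. -/
def symBase (d : ℕ) : specFunctor k (symTensors K d L) ⟶ symPower d (specFunctor k L) :=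
  specMap (symBaseHom k K L d) ≫ (symPowerSpecIso d L).hom

/-- `K` is closed in `L` for the topology defined by the valuation with valuation ring `O`. -/
def IsClosedSubfield (O : Type u) [CommRing O] [IsLocalRing O] [Algebra O L] : Prop :=
  ∀ x : L, (∀ n : ℕ, ∃ y ∈ K, ∃ z ∈ IsLocalRing.maximalIdeal O ^ n, x - y = algebraMap O L z) →
    x ∈ K

/-- The characteristic polynomial of the `K`-linear endomorphism `x ↦ a x` of `L`. -/
def mulCharpoly (a : L) : Polynomial K := (LinearMap.mulLeft K a).charpoly

theorem mulCharpoly_ne_zero (a : L) : mulCharpoly K a ≠ 0 :=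
  (LinearMap.charpoly_monic _).ne_zero

end NormPoint

end LoopSym
end

open LoopSym

/-!
By Yoneda, the composition is a single `K`-point of the loop group: the image of the product
`∏ᵢ (Π - πᵢ)⁻¹ Π` over `TS^d_k(L)` under `TS^d_k(L) → TS^d_K(L) → K`, where `πᵢ` is the image of `π`
under the `i`-th coprojection `L → L ⊗ ⋯ ⊗ L`. The polynomial `∏ᵢ (X - πᵢ)` has symmetric
coefficients, so it comes from a polynomial `q` over `TS^d_k(L)`, and the product is the only
Laurent series `t` with `t · q(Π) = Π^d`; this can be checked in the tensor power, where `t` is the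
product of the images of `(Π - π)⁻¹ Π` under the coprojections (`exists_symProd_laurent`). It remains
to see that the homomorphism to `K` carries `q` to the characteristic polynomial of `π`. The value
of `q` at `c ∈ K` is the diagonal tensor `(c - π) ⊗ ⋯ ⊗ (c - π)`, whose image is the norm of
`c - π`, that is, the value of the characteristic polynomial at `c`. As `K` is infinite (`L` is,
being the fraction field of a discrete valuation ring, and `L/K` is finite), these values determine
the polynomial (`map_symNorm_eq_mulCharpoly`).
-/

noncomputable section
namespace LoopSym

/-! ### The generic split polynomial -/

section SplitPoly

open Polynomial

variable (R : Type*) [CommRing R] (d : ℕ) {B : Type*} [CommRing B] [Algebra R B]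

/-- The polynomial `∏ᵢ (X - aᵢ)` over `B ⊗ ⋯ ⊗ B`, where `aᵢ` is the image of `a` under the `i`-th
coprojection. -/
def splitPoly (a : B) : (⨂[R] _ : Fin d, B)[X] :=
  ∏ i : Fin d, (X - C (PiTensorProduct.singleAlgHom (R := R) (A := fun _ : Fin d => B) i a))

theorem permHom_single_apply (σ : Equiv.Perm (Fin d)) (i : Fin d) (a : B) :
    permHom R d B σ (PiTensorProduct.singleAlgHom (A := fun _ : Fin d => B) i a)
      = PiTensorProduct.singleAlgHom (A := fun _ : Fin d => B) (σ.symm i) a := by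
  simp only [PiTensorProduct.singleAlgHom_apply, permHom_tprod]
  congr 1
  funext j
  simp [Pi.mulSingle_apply, Equiv.eq_symm_apply]

theorem splitPoly_map_permHom (σ : Equiv.Perm (Fin d)) (a : B) :
    (splitPoly R d a).map (permHom R d B σ : _ →+* _) = splitPoly R d a := by
  simp only [splitPoly, Polynomial.map_prod, Polynomial.map_sub, map_X, map_C, RingHom.coe_coe,
    permHom_single_apply]
  exact Equiv.prod_comp σ.symm fun i => X - C (PiTensorProduct.singleAlgHom (R := R)
    (A := fun _ : Fin d => B) i a)

/-- Permuting the tensor factors permutes the linear factors, so `splitPoly R d a` descends to the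
symmetric tensors. -/
theorem exists_map_val_eq_splitPoly (a : B) :
    ∃ q : (symTensors R d B)[X],
      q.map ((symTensors R d B).val : symTensors R d B →+* _) = splitPoly R d a := by
  refine (lifts_iff_coeff_lifts (splitPoly R d a)).2 fun n =>
    ⟨⟨(splitPoly R d a).coeff n, (mem_symTensors R d _).2 fun σ => ?_⟩, rfl⟩
  conv_rhs => rw [← splitPoly_map_permHom R d σ a, coeff_map]
  rfl

theorem prod_single (a : B) :
    ∏ i : Fin d, PiTensorProduct.singleAlgHom (R := R) (A := fun _ : Fin d => B) i a
      = PiTensorProduct.tprod R fun _ => a := by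
  simp only [PiTensorProduct.singleAlgHom_apply]
  rw [← PiTensorProduct.tprod_prod]
  exact congr_arg _ (Finset.univ_prod_mulSingle fun _ : Fin d => a)

theorem eval_splitPoly (a : B) (c : R) :
    (splitPoly R d a).eval (algebraMap R _ c)
      = PiTensorProduct.tprod R fun _ => algebraMap R B c - a := by
  rw [splitPoly, eval_prod, ← prod_single]
  refine Finset.prod_congr rfl fun i _ => ?_
  rw [eval_sub, eval_X, eval_C, map_sub, AlgHom.commutes]

end SplitPoly

/-! ### The norm of the generic split polynomial -/

section NormPoly

open Polynomial

variable {k L : Type u} [Field k] [Field L] [Algebra k L] (K : IntermediateField k L) {d : ℕ}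

theorem eval_mulCharpoly [FiniteDimensional K L] (a : L) (c : K) :
    (mulCharpoly K a).eval c = Algebra.norm K (algebraMap K L c - a) := by
  rw [mulCharpoly, LinearMap.eval_charpoly, Algebra.norm_apply]
  congr 1
  ext x
  simp [Algebra.smul_def]

theorem tensorBaseHom_single (i : Fin d) (a : L) :
    tensorBaseHom k K L d (PiTensorProduct.singleAlgHom (A := fun _ : Fin d => L) i a)
      = PiTensorProduct.singleAlgHom (A := fun _ : Fin d => L) i a := by
  simp only [PiTensorProduct.singleAlgHom_apply, tensorBaseHom_tprod]

theorem splitPoly_map_tensorBaseHom (a : L) :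
    (splitPoly k d a).map (tensorBaseHom k K L d : _ →+* _) = splitPoly K d a := by
  simp only [splitPoly, Polynomial.map_prod, Polynomial.map_sub, map_X, map_C, RingHom.coe_coe,
    tensorBaseHom_single]

/-- Both sides take the same value at every `c ∈ K`: the norm of `c - a`. -/
theorem map_symNorm_eq_mulCharpoly [FiniteDimensional K L] [Infinite K]
    (b : Module.Basis (Fin d) K L) (a : L) (q : (symTensors k d L)[X])
    (hq : q.map ((symTensors k d L).val : symTensors k d L →+* ⨂[k] _ : Fin d, L)
      = splitPoly k d a) :
    q.map ((((symNorm b).restrictScalars k).comp (symBaseHom k K L d) :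
      symTensors k d L →ₐ[k] K) : _ →+* K) = mulCharpoly K a := by
  refine Polynomial.funext fun c => ?_
  have hcomp : ((((symNorm b).restrictScalars k).comp (symBaseHom k K L d) :
      symTensors k d L →ₐ[k] K) : symTensors k d L →+* K)
      = (symNorm b : symTensors K d L →+* K).comp
        (symBaseHom k K L d : symTensors k d L →+* symTensors K d L) := rfl
  -- the value at `c` of the image of `q` over `TS^d_K(L)` is a diagonal tensor
  have hdiag : (q.map (symBaseHom k K L d : symTensors k d L →+* symTensors K d L)).eval
      (algebraMap K _ c) = tensorDiag K d (algebraMap K L c - a) := by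
    refine Subtype.ext ?_
    have hval : (symTensors K d L).val.toRingHom.comp
        (symBaseHom k K L d : symTensors k d L →+* symTensors K d L)
        = (tensorBaseHom k K L d : (⨂[k] _ : Fin d, L) →+* ⨂[K] _ : Fin d, L).comp
          ((symTensors k d L).val : symTensors k d L →+* ⨂[k] _ : Fin d, L) := rfl
    change (symTensors K d L).val.toRingHom _ = _
    rw [← eval₂_id, hom_eval₂, RingHom.comp_id, ← Polynomial.eval_map, Polynomial.map_map, hval,
      ← Polynomial.map_map, hq, splitPoly_map_tensorBaseHom]
    exact eval_splitPoly K d a c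
  rw [eval_mulCharpoly, ← symNorm_tensorDiag b, ← hdiag, hcomp, ← Polynomial.map_map]
  have hc : c = (symNorm b : symTensors K d L →+* K) (algebraMap K _ c) :=
    ((symNorm b).commutes c).symm
  conv_lhs => rw [hc, Polynomial.eval_map, eval₂_at_apply]
  rfl

end NormPoly

/-! ### The loop group point -/

section Point

theorem infinite_of_finite_fractionRing {k L : Type*} (O : Type*) [Field k] [CommRing O]
    [IsDomain O] [IsDiscreteValuationRing O] [Field L] [Algebra O L] [IsFractionRing O L]
    [Algebra k L] [FiniteDimensional k L] : Infinite k := by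
  refine not_finite_iff_infinite.1 fun _ => ?_
  have : Finite L := Module.finite_of_finite k
  have : Finite O := Finite.of_injective _ (IsFractionRing.injective O L)
  exact IsDiscreteValuationRing.not_isField O (Finite.isField_of_domain O)

theorem laurentMap_single {A B : Type*} [CommRing A] [CommRing B] (f : A →+* B) (n : ℤ) (a : A) :
    laurentMap f (HahnSeries.single n a) = HahnSeries.single n (f a) := by
  ext m
  rw [laurentMap_coeff, HahnSeries.coeff_single, HahnSeries.coeff_single]
  split_ifs <;> simp

theorem ofPowerSeries_X_sub_C {A : Type*} [CommRing A] (a : A) :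
    HahnSeries.ofPowerSeries ℤ A ((Polynomial.X - Polynomial.C a : Polynomial A) : PowerSeries A)
      = HahnSeries.single 1 1 - HahnSeries.C a := by
  simp

theorem phiSeries_mul {O L : Type u} [CommRing O] [Field L] [Algebra O L] (ϖ : O) :
    phiSeries L ϖ * (HahnSeries.single 1 1 - HahnSeries.C (algebraMap O L ϖ))
      = HahnSeries.single 1 1 := by
  have h : (HahnSeries.single 1 1 - HahnSeries.C (algebraMap O L ϖ) : LaurentSeries L) ≠ 0 := by
    intro h
    have := congr_arg (fun s => HahnSeries.coeff s 1) h
    simp [HahnSeries.C_apply] at this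
  rw [phiSeries, mul_right_comm, inv_mul_cancel₀ h, one_mul]

variable {k O L : Type u} [Field k] [CommRing O] [IsDomain O] [IsDiscreteValuationRing O]
  [Algebra k O] [HasResidueField k O] [Field L] [Algebra O L] [IsFractionRing O L] [Algebra k L]

/-- The Laurent series over `TS^d_k(L)` of the symmetric product of the point `(Π - π)⁻¹ Π`,
characterized by its product with the descent `q` of `∏ᵢ (X - πᵢ)`. -/
theorem exists_symProd_laurent (d : ℕ) {ϖ : O} (hϖ : Irreducible ϖ)
    (q : Polynomial (symTensors k d L))
    (hq : q.map ((symTensors k d L).val : symTensors k d L →+* ⨂[k] _ : Fin d, L)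
      = splitPoly k d (algebraMap O L ϖ)) :
    ∃ t : LaurentSeries (symTensors k d L),
      laurentEquiv k _ L hϖ t
        = (symProd k O L d (laurentPoint L hϖ L (phiSeries L ϖ)
            (phiSeries_ne_zero L ϖ)).down : LoopRing k O L (symTensors k d L)) ∧
      t * HahnSeries.ofPowerSeries ℤ _ (q : PowerSeries (symTensors k d L))
        = HahnSeries.single 1 1 ^ d := by
  obtain ⟨t, ht⟩ := (laurentEquiv k (symTensors k d L) L hϖ).surjective
    (symProd k O L d (laurentPoint L hϖ L (phiSeries L ϖ) (phiSeries_ne_zero L ϖ)).down).val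
  refine ⟨t, ht, ?_⟩
  have hinj : Function.Injective
      (laurentMap ((symTensors k d L).val : symTensors k d L →+* ⨂[k] _ : Fin d, L)) := by
    intro x y h
    ext n
    exact congr_arg (fun s => HahnSeries.coeff s n) h
  apply hinj
  have hprod : laurentMap ((symTensors k d L).val : symTensors k d L →+* ⨂[k] _ : Fin d, L) t
      = ∏ i : Fin d, laurentMap (PiTensorProduct.singleAlgHom (R := k)
          (A := fun _ : Fin d => L) i : L →+* _) (phiSeries L ϖ) := by
    apply (laurentEquiv k (⨂[k] _ : Fin d, L) L hϖ).injective
    rw [← laurentEquiv_map, ht, ← loopUnitsMap_coe, symProd_spec, tensorProd, Units.coe_prod,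
      map_prod]
    exact Finset.prod_congr rfl fun i _ => laurentEquiv_map L hϖ _ _
  rw [map_mul, hprod, laurentMap_series, ← Polynomial.polynomial_map_coe, hq, splitPoly,
    ← Polynomial.coeToPowerSeries.ringHom_apply, map_prod, map_prod, ← Finset.prod_mul_distrib,
    map_pow, laurentMap_single, map_one]
  have hfactor : ∀ i : Fin d, laurentMap (PiTensorProduct.singleAlgHom (R := k)
        (A := fun _ : Fin d => L) i : L →+* _) (phiSeries L ϖ)
      * HahnSeries.ofPowerSeries ℤ _ (Polynomial.coeToPowerSeries.ringHom
        (Polynomial.X - Polynomial.C (PiTensorProduct.singleAlgHom (R := k)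
          (A := fun _ : Fin d => L) i (algebraMap O L ϖ)))) = HahnSeries.single 1 1 := fun i => by
    rw [Polynomial.coeToPowerSeries.ringHom_apply, ofPowerSeries_X_sub_C]
    have h := congr_arg (laurentMap (PiTensorProduct.singleAlgHom (R := k)
        (A := fun _ : Fin d => L) i : L →+* ⨂[k] _ : Fin d, L)) (phiSeries_mul (L := L) ϖ)
    simpa only [map_mul, map_sub, HahnSeries.C_apply, laurentMap_single, map_one,
      RingHom.coe_coe] using h
  simp only [hfactor, Finset.prod_const, Finset.card_univ, Fintype.card_fin]

/-- The equality of `K`-points underlying the theorem, for any `K`-basis of `L`. -/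
theorem loopUnitsMap_symNorm_symProd {ϖ : O} (hϖ : Irreducible ϖ) (K : IntermediateField k L)
    [FiniteDimensional K L] {d : ℕ} (b : Module.Basis (Fin d) K L) :
    loopUnitsMap k O L (((symNorm b).restrictScalars k).comp (symBaseHom k K L d))
        (symProd k O L d (laurentPoint L hϖ L (phiSeries L ϖ) (phiSeries_ne_zero L ϖ)).down)
      = (laurentPoint L hϖ K (polySeries (mulCharpoly K (algebraMap O L ϖ)) d)
          (polySeries_ne_zero (mulCharpoly_ne_zero K _) d)).down := by
  have : Infinite K := infinite_of_finite_fractionRing (L := L) O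
  obtain ⟨q, hq⟩ := exists_map_val_eq_splitPoly k d (algebraMap O L ϖ)
  obtain ⟨t, ht, htq⟩ := exists_symProd_laurent d hϖ q hq
  refine Units.ext ?_
  rw [loopUnitsMap_coe, ← ht, laurentEquiv_map]
  refine congr_arg (laurentEquiv k K L hϖ) ?_
  have h := congr_arg (laurentMap ((((symNorm b).restrictScalars k).comp (symBaseHom k K L d) :
    symTensors k d L →ₐ[k] K) : _ →+* K)) htq
  rw [map_mul, laurentMap_series, ← Polynomial.polynomial_map_coe,
    map_symNorm_eq_mulCharpoly K b _ q hq, map_pow, laurentMap_single, map_one] at h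
  have hP : HahnSeries.ofPowerSeries ℤ K (mulCharpoly K (algebraMap O L ϖ) : PowerSeries K) ≠ 0 :=
    (map_ne_zero_iff _ HahnSeries.ofPowerSeries_injective).2
      (by simpa using mulCharpoly_ne_zero K (algebraMap O L ϖ))
  rw [Units.val_mk0, polySeries, ← h, mul_comm, mul_assoc, mul_inv_cancel₀ hP, mul_one]

end Point

end LoopSym
end

open LoopSym
/-- `k` is a perfect field and `L` a complete discretely valued extension of `k` with residue field
`k`: it is given as the fraction field of its valuation ring `O`, a complete discrete valuation ring
containing `k`. `ϖ` is a uniformizer, `K` a closed subextension with `L/K` finite of degree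
`d = [L : K]`. -/
theorem proposition3p5 {k O L : Type u} [Field k] [PerfectField k]
    [CommRing O] [IsDomain O] [IsDiscreteValuationRing O]
    [IsAdicComplete (IsLocalRing.maximalIdeal O) O]
    [Algebra k O] [HasResidueField k O]
    [Field L] [Algebra O L] [IsFractionRing O L] [Algebra k L] [IsScalarTower k O L]
    {ϖ : O} (hϖ : Irreducible ϖ)
    (K : IntermediateField k L) (hK : IsClosedSubfield K O) [FiniteDimensional K L] :
    normPoint K ≫ symBase K (Module.finrank K L) ≫
        symPowerMap (Module.finrank K L) (phi L hϖ) ≫ symMul k O L (Module.finrank K L)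
      = ofPoint (laurentPoint L hϖ K
          (polySeries (mulCharpoly K (algebraMap O L ϖ)) (Module.finrank K L))
          (polySeries_ne_zero (mulCharpoly_ne_zero K _) _)) := by
  refine uliftCoyonedaEquiv.{u + 1}.injective ?_
  rw [Equiv.apply_symm_apply]
  have hφ : uliftCoyonedaEquiv.{u + 1} (phi (k := k) L hϖ)
      = laurentPoint L hϖ L (phiSeries L ϖ) (phiSeries_ne_zero L ϖ) :=
    Equiv.apply_symm_apply _ _
  refine Eq.trans ?_ (congr_arg ULift.up
    (loopUnitsMap_symNorm_symProd hϖ K (Module.finBasis K L)))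
  rw [← hφ]
  -- the composition, evaluated at the identity of `K`, unfolds to the left-hand side
  rfl
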